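/- Let $\Gamma_W=\langle a,b\mid aba^{-3}b^2a^{-1}b^{-1}a^3b^{-2}\rangle$ be the fundamental group of the Whitehead link complement. Let $J=\begin{pmatrix}0&0&1\\0&1&0\\1&0&0\end{pmatrix}$, which defines a Hermitian form of signature $(2,1)$, and let $$\mathrm{U}(2,1)=\{A\in \mathrm{GL}_3(\mathbb C): A^*JA=J\},\qquad \mathrm{SU}(2,1)=\{A\in \mathrm{U}(2,1):\det A=1\},\qquad \mathrm{Sp}(2,1)=\{A\in \mathrm{GL}_3(\mathbb H): A^*JA=J\},$$ so that $\mathrm{SU}(2,1)\subset\mathrm{U}(2,1)\subset\mathrm{Sp}(2,1)$ through $\mathbb C\subset\mathbb H$. Let $\rho_W:\Gamma_W\to\mathrm{SU}(2,1)$ be the representation given by $$\rho_W(a)=\begin{pmatrix}1&\frac{\sqrt3-i\sqrt5}{2}&-1\\ \frac{-\sqrt3-i\sqrt5}{2}&-1&0\\-1&0&0\end{pmatrix},\qquad \rho_W(b)=\begin{pmatrix}1&-\frac{\sqrt3+i\sqrt5}{2}&-1\\ \frac{\sqrt3-i\sqrt5}{2}&-1&0\\-1&0&0\end{pmatrix}$$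 (both of order $3$, so that $\rho_W$ factors through $\mathbb Z_3*\mathbb Z_3$), regarded as a representation into $\mathrm{Sp}(2,1)$. Then $\rho_W$ has small deformations in $\mathrm{Sp}(2,1)$ which are not conjugate to any representation into $\mathrm{U}(2,1)$. Precisely, there is a family of representations $\rho_t:\Gamma_W\to\mathrm{Sp}(2,1)$, $t\in[0,1]$, with $\rho_0=\rho_W$ and $t\mapsto\rho_t(\gamma)$ continuous for every $\gamma\in\Gamma_W$, such that for no $t\in(0,1]$ is $\rho_t$ conjugate by an element of $\mathrm{Sp}(2,1)$ to a representation $\Gamma_W\to\mathrm{U}(2,1)$. In particular, such representations exist in every neighbourhood of $\rho_W$ in $\mathrm{Hom}(\Gamma_W,\mathrm{Sp}(2,1))$. -/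

import Mathlib

open scoped Quaternion Matrix

/-- The matrix `J` of the form `⟨z, w⟩ = w₁* z₃ + w₂* z₂ + w₃* z₁` on triples over a star ring `R`.
Over `ℝ`, `ℂ` and `ℍ` the form is Hermitian of signature `(2, 1)`: `J` has the
eigenvalues `1, 1, -1`. -/
def formJ (R : Type*) [Ring R] : Matrix (Fin 3) (Fin 3) R :=
  !![0, 0, 1; 0, 1, 0; 1, 0, 0]

/-- The group of invertible `3 × 3` matrices `A` over `R` with `A* J A = J`. -/
def isometryGroup (R : Type*) [Ring R] [StarRing R] : Subgroup (Matrix (Fin 3) (Fin 3) R)ˣ where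
  carrier := {A | (A : Matrix (Fin 3) (Fin 3) R)ᴴ * formJ R * A = formJ R}
  one_mem' := by simp
  mul_mem' := by
    intro A B hA hB
    simp only [Set.mem_ofPred_eq] at hA hB ⊢
    rw [Units.val_mul, Matrix.conjTranspose_mul]
    calc _ = (B : Matrix (Fin 3) (Fin 3) R)ᴴ *
          ((A : Matrix (Fin 3) (Fin 3) R)ᴴ * formJ R * A) * B := by simp only [mul_assoc]
      _ = _ := by rw [hA, hB]
  inv_mem' := by
    intro A hA
    simp only [Set.mem_ofPred_eq] at hA ⊢
    have h1 : (A : Matrix (Fin 3) (Fin 3) R) * (↑A⁻¹ : Matrix (Fin 3) (Fin 3) R) = 1 := A.mul_inv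
    have h2 : (↑A⁻¹ : Matrix (Fin 3) (Fin 3) R)ᴴ * (A : Matrix (Fin 3) (Fin 3) R)ᴴ = 1 := by
      rw [← Matrix.conjTranspose_mul, h1, Matrix.conjTranspose_one]
    calc (↑A⁻¹ : Matrix (Fin 3) (Fin 3) R)ᴴ * formJ R * (↑A⁻¹ : Matrix (Fin 3) (Fin 3) R)
        = (↑A⁻¹ : Matrix (Fin 3) (Fin 3) R)ᴴ *
          ((A : Matrix (Fin 3) (Fin 3) R)ᴴ * formJ R * A) * (↑A⁻¹ : Matrix (Fin 3) (Fin 3) R) := by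
          rw [hA]
      _ = ((↑A⁻¹ : Matrix (Fin 3) (Fin 3) R)ᴴ * (A : Matrix (Fin 3) (Fin 3) R)ᴴ) * formJ R *
          ((A : Matrix (Fin 3) (Fin 3) R) * (↑A⁻¹ : Matrix (Fin 3) (Fin 3) R)) := by
          simp only [mul_assoc]
      _ = formJ R := by rw [h1, h2, one_mul, mul_one]

/-- `U(2,1)`: the complex matrices preserving `J`. -/
abbrev U21 : Subgroup (Matrix (Fin 3) (Fin 3) ℂ)ˣ := isometryGroup ℂ

/-- `Sp(2,1)`: the quaternionic matrices preserving `J`. It carries the subspace topology coming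
from the matrices. -/
abbrev Sp21 : Subgroup (Matrix (Fin 3) (Fin 3) ℍ[ℝ])ˣ := isometryGroup ℍ[ℝ]

/-- `SU(2,1)`: the elements of `U(2,1)` of determinant `1`. -/
def SU21 : Subgroup U21 where
  carrier := {A | (A.1 : Matrix (Fin 3) (Fin 3) ℂ).det = 1}
  one_mem' := by simp
  mul_mem' := by
    intro A B hA hB
    simp only [Set.mem_ofPred_eq] at hA hB ⊢
    simp [hA, hB]
  inv_mem' := by
    intro A hA
    simp only [Set.mem_ofPred_eq] at hA ⊢
    have h : (A.1 : Matrix (Fin 3) (Fin 3) ℂ) * ((A⁻¹).1 : Matrix (Fin 3) (Fin 3) ℂ) = 1 :=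
      A.1.mul_inv
    have h2 := congrArg Matrix.det h
    rwa [Matrix.det_mul, hA, one_mul, Matrix.det_one] at h2

/-- The inclusion `U(2,1) → Sp(2,1)`, induced by the inclusion `ℂ = ℝ + ℝ i ⊆ ℍ` of the entries. -/
noncomputable def U21.toSp21 : U21 →* Sp21 :=
  ((Units.map (Quaternion.ofComplex.mapMatrix :
      Matrix (Fin 3) (Fin 3) ℂ →ₐ[ℝ] Matrix (Fin 3) (Fin 3) ℍ[ℝ]).toMonoidHom).comp
    U21.subtype).codRestrict Sp21 (by
      rintro ⟨A, hA⟩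
      have hA' : (A : Matrix (Fin 3) (Fin 3) ℂ)ᴴ * formJ ℂ * A = formJ ℂ := hA
      let f : Matrix (Fin 3) (Fin 3) ℂ →ₐ[ℝ] Matrix (Fin 3) (Fin 3) ℍ[ℝ] :=
        Quaternion.ofComplex.mapMatrix
      have hJ : f (formJ ℂ) = formJ ℍ[ℝ] := by
        ext i j : 1
        fin_cases i <;> fin_cases j <;> simp [f, formJ]
      have hs : f (A : Matrix (Fin 3) (Fin 3) ℂ)ᴴ = (f (A : Matrix (Fin 3) (Fin 3) ℂ))ᴴ := by
        ext i j : 1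
        ext <;> simp [f]
      change (f (A : Matrix (Fin 3) (Fin 3) ℂ))ᴴ * formJ ℍ[ℝ] * f A = formJ ℍ[ℝ]
      rw [← hs, ← hJ, ← map_mul, ← map_mul, hA'])

/-- The relator `a b a⁻³ b² a⁻¹ b⁻¹ a³ b⁻²` in the free group on `a = of 0` and `b = of 1`. -/
def whiteheadRelator : FreeGroup (Fin 2) :=
  let a := FreeGroup.of (0 : Fin 2)
  let b := FreeGroup.of (1 : Fin 2)
  a * b * (a ^ 3)⁻¹ * b ^ 2 * a⁻¹ * b⁻¹ * a ^ 3 * (b ^ 2)⁻¹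

/-- The Whitehead link group `⟨a, b | a b a⁻³ b² a⁻¹ b⁻¹ a³ b⁻²⟩`. -/
abbrev WhiteheadGroup : Type := PresentedGroup ({whiteheadRelator} : Set (FreeGroup (Fin 2)))

/-- The matrix `ρ_W(a)`. -/
noncomputable def matrixA : Matrix (Fin 3) (Fin 3) ℂ :=
  !![1, ((√3 : ℝ) - Complex.I * (√5 : ℝ)) / 2, -1;
     (-(√3 : ℝ) - Complex.I * (√5 : ℝ)) / 2, -1, 0;
     -1, 0, 0]

/-- The matrix `ρ_W(b)`. -/
noncomputable def matrixB : Matrix (Fin 3) (Fin 3) ℂ :=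
  !![1, -(((√3 : ℝ) + Complex.I * (√5 : ℝ)) / 2), -1;
     ((√3 : ℝ) - Complex.I * (√5 : ℝ)) / 2, -1, 0;
     -1, 0, 0]

theorem sqrt_three_sq : ((√3 : ℝ) : ℂ) ^ 2 = 3 := by
  rw [← Complex.ofReal_pow, Real.sq_sqrt (by norm_num)]; norm_num

theorem sqrt_five_sq : ((√5 : ℝ) : ℂ) ^ 2 = 5 := by
  rw [← Complex.ofReal_pow, Real.sq_sqrt (by norm_num)]; norm_num

theorem matrixA_cube : matrixA * (matrixA * matrixA) = 1 := by
  have h3 := sqrt_three_sq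
  have h5 := sqrt_five_sq
  have hI := Complex.I_sq
  ext i j
  fin_cases i <;> fin_cases j <;>
    simp [matrixA, Matrix.mul_apply, Fin.sum_univ_three] <;> grind

theorem matrixB_cube : matrixB * (matrixB * matrixB) = 1 := by
  have h3 := sqrt_three_sq
  have h5 := sqrt_five_sq
  have hI := Complex.I_sq
  ext i j
  fin_cases i <;> fin_cases j <;>
    simp [matrixB, Matrix.mul_apply, Fin.sum_univ_three] <;> grind

theorem matrixA_form : matrixAᴴ * formJ ℂ * matrixA = formJ ℂ := by
  have h3 := sqrt_three_sq
  have h5 := sqrt_five_sq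
  have hI := Complex.I_sq
  have h2 : (starRingEnd ℂ) 2 = 2 := map_ofNat _ 2
  ext i j
  fin_cases i <;> fin_cases j <;>
    simp [matrixA, formJ, h2, Matrix.mul_apply, Fin.sum_univ_three] <;> grind

theorem matrixB_form : matrixBᴴ * formJ ℂ * matrixB = formJ ℂ := by
  have h3 := sqrt_three_sq
  have h5 := sqrt_five_sq
  have hI := Complex.I_sq
  have h2 : (starRingEnd ℂ) 2 = 2 := map_ofNat _ 2
  ext i j
  fin_cases i <;> fin_cases j <;>
    simp [matrixB, formJ, h2, Matrix.mul_apply, Fin.sum_univ_three] <;> grind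

/-- `ρ_W(a)` as an element of `SU(2,1)`. -/
noncomputable def genA : SU21 :=
  ⟨⟨⟨matrixA, matrixA * matrixA, matrixA_cube, by rw [mul_assoc, matrixA_cube]⟩, matrixA_form⟩, by
    change matrixA.det = 1
    simp [matrixA, Matrix.det_fin_three]⟩

/-- `ρ_W(b)` as an element of `SU(2,1)`. -/
noncomputable def genB : SU21 :=
  ⟨⟨⟨matrixB, matrixB * matrixB, matrixB_cube, by rw [mul_assoc, matrixB_cube]⟩, matrixB_form⟩, by
    change matrixB.det = 1
    simp [matrixB, Matrix.det_fin_three]⟩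

theorem genA_cube : genA ^ 3 = 1 := by
  apply Subtype.ext; apply Subtype.ext; apply Units.ext
  change matrixA ^ 3 = 1
  rw [pow_succ', pow_two, matrixA_cube]

theorem genB_cube : genB ^ 3 = 1 := by
  apply Subtype.ext; apply Subtype.ext; apply Units.ext
  change matrixB ^ 3 = 1
  rw [pow_succ', pow_two, matrixB_cube]

/-- The representation `ρ_W : Γ_W → SU(2,1)`. -/
noncomputable def rhoWSU : WhiteheadGroup →* SU21 :=
  PresentedGroup.toGroup (f := ![genA, genB]) (by
    intro r hr
    rw [Set.mem_singleton_iff] at hr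
    subst hr
    have hb : genB ^ 2 = genB⁻¹ := by
      rw [eq_inv_iff_mul_eq_one, ← pow_succ, genB_cube]
    simp [whiteheadRelator, genA_cube, hb])

/-- The representation `ρ_W`, taken as a representation into `Sp(2,1)`. -/
noncomputable def rhoW : WhiteheadGroup →* Sp21 :=
  U21.toSp21.comp (SU21.subtype.comp rhoWSU)

/-- `ρ : Γ_W → Sp(2,1)` is conjugate in `Sp(2,1)` to a representation `σ : Γ_W → U(2,1)`. -/
def IsConjIntoU21 (ρ : WhiteheadGroup →* Sp21) : Prop :=
  ∃ (σ : WhiteheadGroup →* U21) (g : Sp21), ∀ γ, g * ρ γ * g⁻¹ = U21.toSp21 (σ γ)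

/-! When the images of a and b both have cube 1, the relator becomes trivial, so the image of b may
be conjugated by any isometry T without leaving the representation variety. Taking T to be the
unipotent isometry with corner entry s j gives `bending s`, which starts at ρ_W for s = 0.

A representation conjugate into U(2,1) commutes with a conjugate P of the scalar i, and P² = -1
(`IsConjIntoU21.exists_commute`). The vectors fixed by ρ_W(b) form a single right quaternionic line,
so the image B' of b fixes exactly the line of U = T `fixedB`. Since P commutes with B', it
preserves this line: P U = U μ with μ² = -1. As P is an isometry, the unit quaternion μ commutes
with ⟨K U, U⟩ for each K commuting with P. For K = A = ρ_W(a) and K = A⁻¹ B' A these products have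
linearly independent imaginary parts when s ≠ 0, whereas the centraliser of μ is only ℝ + ℝ μ. -/

/-- The quaternion `a + b i + c j + d k`. -/
def quat (a b c d : ℝ) : ℍ[ℝ] := ⟨a, b, c, d⟩

section quat

variable (a b c d : ℝ)

@[simp] theorem quat_re : (quat a b c d).re = a := rfl

@[simp] theorem quat_imI : (quat a b c d).imI = b := rfl

@[simp] theorem quat_imJ : (quat a b c d).imJ = c := rfl

@[simp] theorem quat_imK : (quat a b c d).imK = d := rfl

theorem star_quat : star (quat a b c d) = quat a (-b) (-c) (-d) := by
  ext <;> simp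

end quat

/-! ### The bending family -/

/-- The quaternion `s j`. -/
def quatJ (s : ℝ) : ℍ[ℝ] := quat 0 0 s 0

theorem quatJ_eq_smul (s : ℝ) : quatJ s = s • quatJ 1 := by
  ext <;> simp [quatJ]

@[simp] theorem star_quatJ (s : ℝ) : star (quatJ s) = -quatJ s := by
  ext <;> simp [quatJ]

theorem continuous_quatJ : Continuous quatJ := by
  rw [funext quatJ_eq_smul]; fun_prop

/-- The unipotent isometry of the form `J` with upper right entry `s j`, where `s` is real. -/
noncomputable def jTranslation (s : ℝ) : Sp21 :=
  ⟨⟨!![1, 0, quatJ s; 0, 1, 0; 0, 0, 1], !![1, 0, -quatJ s; 0, 1, 0; 0, 0, 1], by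
    ext i j : 1
    fin_cases i <;> fin_cases j <;> simp [Matrix.mul_apply, Fin.sum_univ_three], by
    ext i j : 1
    fin_cases i <;> fin_cases j <;> simp [Matrix.mul_apply, Fin.sum_univ_three]⟩, by
    change (_ : Matrix (Fin 3) (Fin 3) ℍ[ℝ])ᴴ * _ * _ = _
    ext i j : 1
    fin_cases i <;> fin_cases j <;>
      simp [formJ, Matrix.mul_apply, Fin.sum_univ_three]⟩

theorem jTranslation_val (s : ℝ) : ((jTranslation s).1 : Matrix (Fin 3) (Fin 3) ℍ[ℝ]) =
    !![1, 0, quatJ s; 0, 1, 0; 0, 0, 1] := rfl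

theorem jTranslation_zero : jTranslation 0 = 1 := by
  have h : quatJ 0 = 0 := by ext <;> simp [quatJ]
  apply Subtype.ext; apply Units.ext
  rw [jTranslation_val, h, ← Matrix.one_fin_three]; rfl

theorem continuous_jTranslation : Continuous jTranslation := by
  refine Continuous.subtype_mk (Units.continuous_iff.2 ⟨?_, ?_⟩) _
  · refine continuous_matrix fun i j => ?_
    fin_cases i <;> fin_cases j <;> first | exact continuous_const | exact continuous_quatJ
  · refine continuous_matrix fun i j => ?_
    fin_cases i <;> fin_cases j <;> first | exact continuous_const | exact continuous_quatJ.neg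

/-- The element `ρ_W(a)` of `Sp(2,1)`. -/
noncomputable def spA : Sp21 := U21.toSp21 genA.1

/-- The element `ρ_W(b)` of `Sp(2,1)`. -/
noncomputable def spB : Sp21 := U21.toSp21 genB.1

theorem spA_cube : spA ^ 3 = 1 := by
  have h : (genA ^ 3).1 = 1 := by rw [genA_cube]; rfl
  rw [spA, ← map_pow, ← Subgroup.coe_pow, h, map_one]

theorem spB_cube : spB ^ 3 = 1 := by
  have h : (genB ^ 3).1 = 1 := by rw [genB_cube]; rfl
  rw [spB, ← map_pow, ← Subgroup.coe_pow, h, map_one]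

/-- A pair of elements of order dividing `3` defines a representation of the Whitehead link
group. -/
def ofCubes {G : Type*} [Group G] (x y : G) (hx : x ^ 3 = 1) (hy : y ^ 3 = 1) :
    WhiteheadGroup →* G :=
  PresentedGroup.toGroup (f := ![x, y]) (by
    intro r hr
    rw [Set.mem_singleton_iff] at hr
    subst hr
    -- With cubes trivial, the relator reduces to x y y⁻¹ x⁻¹ y⁻¹ y.
    have hb : y ^ 2 = y⁻¹ := by rw [eq_inv_iff_mul_eq_one, ← pow_succ, hy]
    simp [whiteheadRelator, hx, hb])

@[simp] theorem ofCubes_of_zero {G : Type*} [Group G] (x y : G) (hx : x ^ 3 = 1)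
    (hy : y ^ 3 = 1) : ofCubes x y hx hy (PresentedGroup.of 0) = x :=
  PresentedGroup.toGroup.of _

@[simp] theorem ofCubes_of_one {G : Type*} [Group G] (x y : G) (hx : x ^ 3 = 1)
    (hy : y ^ 3 = 1) : ofCubes x y hx hy (PresentedGroup.of 1) = y :=
  PresentedGroup.toGroup.of _

theorem jConj_cube (s : ℝ) : (jTranslation s * spB * (jTranslation s)⁻¹) ^ 3 = 1 := by
  rw [conj_pow, spB_cube, mul_one, mul_inv_cancel]

/-- The deformation of `ρ_W` that fixes the image of `a` and conjugates the image of `b` by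
`jTranslation s`. -/
noncomputable def bending (s : ℝ) : WhiteheadGroup →* Sp21 :=
  ofCubes spA (jTranslation s * spB * (jTranslation s)⁻¹) spA_cube (jConj_cube s)

theorem bending_zero : bending 0 = rhoW := by
  refine PresentedGroup.ext fun i => ?_
  fin_cases i
  · change bending 0 (PresentedGroup.of 0) = U21.toSp21 (rhoWSU (PresentedGroup.of 0)).1
    rw [rhoWSU, PresentedGroup.toGroup.of, bending, ofCubes_of_zero]; rfl
  · change bending 0 (PresentedGroup.of 1) = U21.toSp21 (rhoWSU (PresentedGroup.of 1)).1
    rw [rhoWSU, PresentedGroup.toGroup.of, bending, ofCubes_of_one, jTranslation_zero, one_mul,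
      inv_one, mul_one]; rfl

/-- Pointwise continuity passes to products and inverses in a topological group. -/
theorem continuous_of_continuous_generators {α : Type*} {X G : Type*} [TopologicalSpace X]
    [Group G] [TopologicalSpace G] [IsTopologicalGroup G] {rels : Set (FreeGroup α)}
    (ρ : X → PresentedGroup rels →* G)
    (h : ∀ i, Continuous fun x => ρ x (PresentedGroup.of i)) (γ : PresentedGroup rels) :
    Continuous fun x => ρ x γ := by
  have hγ : γ ∈ Subgroup.closure (Set.range (PresentedGroup.of (rels := rels))) := by
    rw [PresentedGroup.closure_range_of]; trivial
  induction hγ using Subgroup.closure_induction with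
  | mem x hx => obtain ⟨i, rfl⟩ := hx; exact h i
  | one => simpa using continuous_const
  | mul x y _ _ hx hy => simp only [map_mul]; exact hx.mul hy
  | inv x _ hx => simp only [map_inv]; exact hx.inv

theorem continuous_bending (γ : WhiteheadGroup) : Continuous fun s => bending s γ := by
  refine continuous_of_continuous_generators bending (fun i => ?_) γ
  fin_cases i
  · simpa [bending] using continuous_const
  · have h (s : ℝ) : bending s (PresentedGroup.of 1) =
        jTranslation s * spB * (jTranslation s)⁻¹ := ofCubes_of_one _ _ _ _
    exact ((continuous_jTranslation.mul continuous_const).mul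
      continuous_jTranslation.inv).congr fun s => (h s).symm

/-! ### The fixed line of ρ_W(b) -/

/-- The upper middle entry of `ρ_W(a)`, as a quaternion. -/
noncomputable def entryA : ℍ[ℝ] := quat (√3 / 2) (-(√5 / 2)) 0 0

/-- The upper middle entry of `ρ_W(b)`, as a quaternion. -/
noncomputable def entryB : ℍ[ℝ] := quat (-(√3 / 2)) (-(√5 / 2)) 0 0

theorem spA_val : (spA.1 : Matrix (Fin 3) (Fin 3) ℍ[ℝ]) =
    !![1, entryA, -1; -star entryA, -1, 0; -1, 0, 0] := by
  change (Quaternion.ofComplex.mapMatrix matrixA : Matrix (Fin 3) (Fin 3) ℍ[ℝ]) = _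
  ext i j <;> fin_cases i <;> fin_cases j <;> simp [matrixA, entryA, star_quat] <;> ring

theorem spB_val : (spB.1 : Matrix (Fin 3) (Fin 3) ℍ[ℝ]) =
    !![1, entryB, -1; -star entryB, -1, 0; -1, 0, 0] := by
  change (Quaternion.ofComplex.mapMatrix matrixB : Matrix (Fin 3) (Fin 3) ℍ[ℝ]) = _
  ext i j <;> fin_cases i <;> fin_cases j <;> simp [matrixB, entryB, star_quat] <;> ring

/-- A fixed vector of `ρ_W(b)`. -/
noncomputable def fixedB : Matrix (Fin 3) (Fin 1) ℍ[ℝ] := !![-entryB; 1; entryB]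

/-- The squared norm is (3 + 5) / 4; it makes the middle coordinate of `fixedB` come out as 2 - 1 =
1. -/
theorem star_entryB_mul : star entryB * entryB = 1 + 1 := by
  have h3 : √3 * √3 = 3 := Real.mul_self_sqrt (by norm_num)
  have h5 : √5 * √5 = 5 := Real.mul_self_sqrt (by norm_num)
  rw [entryB, star_quat]
  ext <;> simp <;> linarith

theorem spB_mul_fixedB : (spB.1 : Matrix (Fin 3) (Fin 3) ℍ[ℝ]) * fixedB = fixedB := by
  rw [spB_val]
  ext i j : 1
  fin_cases i <;> fin_cases j <;>
    simp [fixedB, Matrix.mul_apply, Fin.sum_univ_three, star_entryB_mul]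

/-- The vectors fixed by `ρ_W(b)` are the right multiples of `fixedB`. -/
theorem eq_fixedB_mul {V : Matrix (Fin 3) (Fin 1) ℍ[ℝ]}
    (hV : (spB.1 : Matrix (Fin 3) (Fin 3) ℍ[ℝ]) * V = V) : V = fixedB * !![V 1 0] := by
  rw [spB_val] at hV
  have h0 := congrFun (congrFun hV 0) 0
  have h2 := congrFun (congrFun hV 2) 0
  simp [Matrix.mul_apply, Fin.sum_univ_three] at h0 h2
  have h20 : V 2 0 = entryB * V 1 0 := by
    rw [← sub_eq_zero, ← neg_eq_zero]
    rw [← sub_eq_zero] at h0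
    rw [← h0]; abel
  have h00 : V 0 0 = -(entryB * V 1 0) := by rw [← h20, ← h2, neg_neg]
  ext i j : 1
  fin_cases i <;> fin_cases j
  · simpa [fixedB, Matrix.mul_apply] using h00
  · simp [fixedB, Matrix.mul_apply]
  · simpa [fixedB, Matrix.mul_apply] using h20

/-! ### The obstruction to being conjugate into U(2,1) -/

/-- Multiplication by `i`, as an element of `U(2,1)`. -/
noncomputable def scalarI : U21 :=
  ⟨⟨Complex.I • 1, -Complex.I • 1, by simp [smul_smul], by simp [smul_smul]⟩, by
    change (Complex.I • (1 : Matrix (Fin 3) (Fin 3) ℂ))ᴴ * _ * (Complex.I • 1) = _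
    simp [smul_smul]⟩

theorem scalarI_val : (scalarI.1 : Matrix (Fin 3) (Fin 3) ℂ) = Complex.I • 1 := rfl

theorem commute_scalarI (A : U21) : Commute scalarI A := by
  apply Subtype.ext; apply Units.ext
  simp [scalarI_val]

theorem toSp21_scalarI_sq : ((U21.toSp21 scalarI).1 : Matrix (Fin 3) (Fin 3) ℍ[ℝ]) *
    ((U21.toSp21 scalarI).1 : Matrix (Fin 3) (Fin 3) ℍ[ℝ]) = -1 := by
  change (Quaternion.ofComplex.mapMatrix (Complex.I • 1) : Matrix (Fin 3) (Fin 3) ℍ[ℝ]) *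
    Quaternion.ofComplex.mapMatrix (Complex.I • 1) = -1
  rw [← map_mul, smul_mul_smul, Complex.I_mul_I, one_mul, neg_smul, one_smul, map_neg, map_one]

/-- The image of a representation that is conjugate into `U(2,1)` commutes with an isometry
of square `-1`. -/
theorem IsConjIntoU21.exists_commute {ρ : WhiteheadGroup →* Sp21} (h : IsConjIntoU21 ρ) :
    ∃ P : Sp21, (P.1 : Matrix (Fin 3) (Fin 3) ℍ[ℝ]) * (P.1 : Matrix (Fin 3) (Fin 3) ℍ[ℝ]) = -1 ∧
      ∀ γ, Commute P (ρ γ) := by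
  obtain ⟨σ, g, hg⟩ := h
  refine ⟨g⁻¹ * U21.toSp21 scalarI * g, ?_, fun γ => ?_⟩
  · have h1 : (g.1 : Matrix (Fin 3) (Fin 3) ℍ[ℝ]) * ((g⁻¹).1 : Matrix (Fin 3) (Fin 3) ℍ[ℝ]) = 1 :=
      g.1.mul_inv
    have h2 : ((g⁻¹).1 : Matrix (Fin 3) (Fin 3) ℍ[ℝ]) * (g.1 : Matrix (Fin 3) (Fin 3) ℍ[ℝ]) = 1 :=
      g.1.inv_mul
    simp only [Subgroup.coe_mul, Units.val_mul]
    set I := ((U21.toSp21 scalarI).1 : Matrix (Fin 3) (Fin 3) ℍ[ℝ]) with hI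
    set G := (g.1 : Matrix (Fin 3) (Fin 3) ℍ[ℝ])
    set G' := ((g⁻¹).1 : Matrix (Fin 3) (Fin 3) ℍ[ℝ])
    calc G' * I * G * (G' * I * G) = G' * I * (G * G') * I * G := by simp only [mul_assoc]
      _ = G' * (I * I) * G := by rw [h1]; simp only [mul_assoc, one_mul]
      _ = -1 := by rw [hI, toSp21_scalarI_sq, mul_neg, mul_one, neg_mul, h2]
  · have hρ : ρ γ = g⁻¹ * U21.toSp21 (σ γ) * g := by rw [← hg γ]; group
    have hc : U21.toSp21 scalarI * U21.toSp21 (σ γ) = U21.toSp21 (σ γ) * U21.toSp21 scalarI :=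
      (commute_scalarI (σ γ)).map U21.toSp21
    rw [hρ]
    calc g⁻¹ * U21.toSp21 scalarI * g * (g⁻¹ * U21.toSp21 (σ γ) * g)
        = g⁻¹ * (U21.toSp21 scalarI * U21.toSp21 (σ γ)) * g := by group
      _ = g⁻¹ * U21.toSp21 (σ γ) * g * (g⁻¹ * U21.toSp21 scalarI * g) := by rw [hc]; group

/-- If an isometry `P` acts on the column `U` as the scalar `m`, then `m` preserves all the
products `⟨K U, U⟩` with `K` commuting with `P`. -/
theorem conjTranspose_mul_gram_mul {P K : Sp21} (hPK : Commute P K)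
    {U : Matrix (Fin 3) (Fin 1) ℍ[ℝ]} {m : Matrix (Fin 1) (Fin 1) ℍ[ℝ]}
    (hm : (P.1 : Matrix (Fin 3) (Fin 3) ℍ[ℝ]) * U = U * m) :
    mᴴ * (Uᴴ * (formJ ℍ[ℝ] * ((K.1 : Matrix (Fin 3) (Fin 3) ℍ[ℝ]) * U))) * m =
      Uᴴ * (formJ ℍ[ℝ] * ((K.1 : Matrix (Fin 3) (Fin 3) ℍ[ℝ]) * U)) := by
  have hP : (P.1 : Matrix (Fin 3) (Fin 3) ℍ[ℝ])ᴴ * formJ ℍ[ℝ] * P.1 = formJ ℍ[ℝ] := P.2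
  have hc : (P.1 : Matrix (Fin 3) (Fin 3) ℍ[ℝ]) * K.1 = K.1 * P.1 :=
    congrArg (fun M : Sp21 => (M.1 : Matrix (Fin 3) (Fin 3) ℍ[ℝ])) hPK.eq
  set Q := (P.1 : Matrix (Fin 3) (Fin 3) ℍ[ℝ])
  set L := (K.1 : Matrix (Fin 3) (Fin 3) ℍ[ℝ])
  calc mᴴ * (Uᴴ * (formJ ℍ[ℝ] * (L * U))) * m
      = (U * m)ᴴ * (formJ ℍ[ℝ] * (L * (U * m))) := by
        simp only [Matrix.conjTranspose_mul, Matrix.mul_assoc]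
    _ = Uᴴ * (Qᴴ * formJ ℍ[ℝ] * (L * Q) * U) := by
        rw [← hm]; simp only [Matrix.conjTranspose_mul, Matrix.mul_assoc]
    _ = Uᴴ * (Qᴴ * formJ ℍ[ℝ] * Q * (L * U)) := by
        rw [← hc]; simp only [Matrix.mul_assoc]
    _ = Uᴴ * (formJ ℍ[ℝ] * (L * U)) := by rw [hP]

/-- The norm is multiplicative and nonnegative, so its value at μ must be 1. -/
theorem mul_star_eq_one_of_mul_self {μ : ℍ[ℝ]} (hμ : μ * μ = -1) : μ * star μ = 1 := by
  have h : Quaternion.normSq μ * Quaternion.normSq μ = 1 := by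
    rw [← map_mul, hμ, Quaternion.normSq_neg, map_one]
  have h0 : 0 ≤ Quaternion.normSq μ := Quaternion.normSq_nonneg
  have h1 : Quaternion.normSq μ = 1 := by nlinarith
  rw [Quaternion.self_mul_star, h1]; rfl

/-- A square root of `-1` does not commute with two quaternions whose imaginary parts are
linearly independent. -/
theorem not_commute_of_mul_self {μ x y : ℍ[ℝ]} (hμ : μ * μ = -1) (hxI : x.imI = 0)
    (hxJ : x.imJ ≠ 0) (hyI : y.imI ≠ 0) (hx : Commute μ x) (hy : Commute μ y) : False := by
  have hxK := congrArg (fun q : ℍ[ℝ] => q.imK) hx.eq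
  have hyJ := congrArg (fun q : ℍ[ℝ] => q.imJ) hy.eq
  have hyK := congrArg (fun q : ℍ[ℝ] => q.imK) hy.eq
  have hre := congrArg (fun q : ℍ[ℝ] => q.re) hμ
  simp [hxI] at hxK hyJ hyK hre
  have h1 : μ.imI = 0 := by
    have : μ.imI * x.imJ = 0 := by linarith
    simpa [hxJ] using this
  rw [h1] at hyJ hyK hre
  have h2 : μ.imK = 0 := by
    have : μ.imK * y.imI = 0 := by linarith
    simpa [hyI] using this
  have h3 : μ.imJ = 0 := by
    have : μ.imJ * y.imI = 0 := by linarith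
    simpa [hyI] using this
  rw [h2, h3] at hre
  nlinarith [mul_self_nonneg μ.re]

/-! ### The two Hermitian products -/

/-- The vector `fixedB`, translated by `jTranslation s`. -/
noncomputable def fixedConj (s : ℝ) : Matrix (Fin 3) (Fin 1) ℍ[ℝ] :=
  !![quat (√3 / 2) (√5 / 2) (-(√3 * s / 2)) (√5 * s / 2); 1; entryB]

theorem jTranslation_mul_fixedB (s : ℝ) :
    ((jTranslation s).1 : Matrix (Fin 3) (Fin 3) ℍ[ℝ]) * fixedB = fixedConj s := by
  rw [jTranslation_val]
  ext i j <;> fin_cases i <;> fin_cases j <;>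
    simp [fixedConj, fixedB, entryB, quatJ, Matrix.mul_apply, Fin.sum_univ_three] <;>
    ring

/-- The image of `fixedConj s` under `ρ_W(a)`. -/
noncomputable def fixedConjA (s : ℝ) : Matrix (Fin 3) (Fin 1) ℍ[ℝ] :=
  !![quat (3 * √3 / 2) (√5 / 2) (-(√3 * s / 2)) (√5 * s / 2);
    quat (-(1 / 2)) (-(√3 * √5 / 2)) (2 * s) 0;
    quat (-(√3 / 2)) (-(√5 / 2)) (√3 * s / 2) (-(√5 * s / 2))]

theorem spA_mul_fixedConj (s : ℝ) :
    (spA.1 : Matrix (Fin 3) (Fin 3) ℍ[ℝ]) * fixedConj s = fixedConjA s := by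
  have h3 : √3 * √3 = 3 := Real.mul_self_sqrt (by norm_num)
  have h5 : √5 * √5 = 5 := Real.mul_self_sqrt (by norm_num)
  have h3s : √3 * √3 * s = 3 * s := by rw [h3]
  have h5s : √5 * √5 * s = 5 * s := by rw [h5]
  rw [spA_val]
  ext i j <;> fin_cases i <;> fin_cases j <;>
    simp [fixedConj, fixedConjA, entryA, entryB, star_quat, Matrix.mul_apply, Fin.sum_univ_three] <;>
    linarith

/-- The image of `fixedConjA s` under the inverse of `jTranslation s`. -/
noncomputable def fixedConjA' (s : ℝ) : Matrix (Fin 3) (Fin 1) ℍ[ℝ] :=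
  !![quat (3 * √3 / 2 + √3 * s ^ 2 / 2) (√5 / 2 + √5 * s ^ 2 / 2) 0 0;
    quat (-(1 / 2)) (-(√3 * √5 / 2)) (2 * s) 0;
    quat (-(√3 / 2)) (-(√5 / 2)) (√3 * s / 2) (-(√5 * s / 2))]

theorem jTranslation_mul_fixedConjA' (s : ℝ) :
    ((jTranslation s).1 : Matrix (Fin 3) (Fin 3) ℍ[ℝ]) * fixedConjA' s = fixedConjA s := by
  rw [jTranslation_val]
  ext i j <;> fin_cases i <;> fin_cases j <;>
    simp [fixedConjA', fixedConjA, quatJ, Matrix.mul_apply, Fin.sum_univ_three] <;>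
    ring

/-- The product for K = A: it has no i-part, and its j-part detects s. -/
theorem gram_fixedConjA (s : ℝ) :
    (((fixedConj s)ᴴ * (formJ ℍ[ℝ] * fixedConjA s)) 0 0).imI = 0 ∧
    (((fixedConj s)ᴴ * (formJ ℍ[ℝ] * fixedConjA s)) 0 0).imJ = 3 / 2 * s := by
  have h3 : √3 * √3 = 3 := Real.mul_self_sqrt (by norm_num)
  have h5 : √5 * √5 = 5 := Real.mul_self_sqrt (by norm_num)
  constructor <;>
    simp [fixedConj, fixedConjA, entryB, star_quat, formJ, Matrix.mul_apply, Fin.sum_univ_three]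
  · ring
  · linear_combination s / 4 * h3 - s / 4 * h5

/-- The product for K = A⁻¹ B' A, moved by the isometry T⁻¹ A; its i-part is positive for every s.
-/
theorem gram_fixedConjA' (s : ℝ) :
    (((fixedConjA' s)ᴴ * (formJ ℍ[ℝ] * ((spB.1 : Matrix (Fin 3) (Fin 3) ℍ[ℝ]) *
      fixedConjA' s))) 0 0).imI = √3 * √5 * (3 / 2 + 2 * s ^ 2) := by
  have h3 : √3 * √3 = 3 := Real.mul_self_sqrt (by norm_num)
  have h5 : √5 * √5 = 5 := Real.mul_self_sqrt (by norm_num)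
  rw [spB_val]
  simp [fixedConjA', entryB, star_quat, formJ, Matrix.mul_apply, Fin.sum_univ_three]
  linear_combination (√3 * √5 * s ^ 2 / 8 + √3 * √5 / 4) * h3 + √3 * √5 * s ^ 2 / 8 * h5

theorem not_isConjIntoU21_bending {s : ℝ} (hs : s ≠ 0) : ¬ IsConjIntoU21 (bending s) := by
  intro h
  obtain ⟨P, hP, hcomm⟩ := h.exists_commute
  set T := jTranslation s
  have hA : Commute P spA := by
    simpa [bending] using hcomm (PresentedGroup.of 0)
  have hB : Commute P (T * spB * T⁻¹) := by
    have := hcomm (PresentedGroup.of 1)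
    rwa [bending, ofCubes_of_one] at this
  have hU := jTranslation_mul_fixedB s
  set U := fixedConj s with hUdef
  -- T⁻¹ P T commutes with ρ_W(b), hence preserves its fixed line.
  have hfix : ((T⁻¹ * P * T).1 : Matrix (Fin 3) (Fin 3) ℍ[ℝ]) * fixedB =
      fixedB * !![(((T⁻¹ * P * T).1 : Matrix (Fin 3) (Fin 3) ℍ[ℝ]) * fixedB) 1 0] := by
    apply eq_fixedB_mul
    have hc : spB * (T⁻¹ * P * T) = T⁻¹ * P * T * spB := by
      calc spB * (T⁻¹ * P * T) = T⁻¹ * ((T * spB * T⁻¹) * P) * T := by group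
        _ = T⁻¹ * P * T * spB := by rw [← hB.eq]; group
    have hc' : (spB.1 : Matrix (Fin 3) (Fin 3) ℍ[ℝ]) * (T⁻¹ * P * T).1 =
        (T⁻¹ * P * T).1 * spB.1 :=
      congrArg (fun M : Sp21 => (M.1 : Matrix (Fin 3) (Fin 3) ℍ[ℝ])) hc
    rw [← Matrix.mul_assoc, hc', Matrix.mul_assoc, spB_mul_fixedB]
  set μ := (((T⁻¹ * P * T).1 : Matrix (Fin 3) (Fin 3) ℍ[ℝ]) * fixedB) 1 0
  have hm : (P.1 : Matrix (Fin 3) (Fin 3) ℍ[ℝ]) * U = U * !![μ] := by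
    have hc : (T.1 : Matrix (Fin 3) (Fin 3) ℍ[ℝ]) * (T⁻¹ * P * T).1 = P.1 * T.1 :=
      congrArg (fun M : Sp21 => (M.1 : Matrix (Fin 3) (Fin 3) ℍ[ℝ]))
        (show T * (T⁻¹ * P * T) = P * T by group)
    rw [← hU, ← Matrix.mul_assoc, ← hc, Matrix.mul_assoc, hfix, Matrix.mul_assoc]
  have hμ : μ * μ = -1 := by
    have h1 : U * (!![μ] * !![μ]) = -U := by
      rw [← Matrix.mul_assoc, ← hm, Matrix.mul_assoc, ← hm, ← Matrix.mul_assoc, hP,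
        Matrix.neg_mul, Matrix.one_mul]
    -- The middle coordinate of U is 1, so that row reads off μ².
    simpa [hUdef, fixedConj, Matrix.mul_apply] using congrFun (congrFun h1 1) 0
  have key (K : Sp21) (hK : Commute P K) :
      Commute μ ((Uᴴ * (formJ ℍ[ℝ] * ((K.1 : Matrix (Fin 3) (Fin 3) ℍ[ℝ]) * U))) 0 0) := by
    have h1 := conjTranspose_mul_gram_mul hK hm
    set x := Uᴴ * (formJ ℍ[ℝ] * ((K.1 : Matrix (Fin 3) (Fin 3) ℍ[ℝ]) * U))
    have h2 : star μ * x 0 0 * μ = x 0 0 := by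
      simpa [Matrix.mul_apply] using congrFun (congrFun h1 0) 0
    calc μ * x 0 0 = μ * (star μ * x 0 0 * μ) := by rw [h2]
      _ = (μ * star μ) * (x 0 0 * μ) := by simp only [mul_assoc]
      _ = x 0 0 * μ := by rw [mul_star_eq_one_of_mul_self hμ, one_mul]
  have hx := key spA hA
  rw [spA_mul_fixedConj] at hx
  have hy := key (spA⁻¹ * (T * spB * T⁻¹) * spA) ((hA.inv_right.mul_right hB).mul_right hA)
  have hgram : Uᴴ * (formJ ℍ[ℝ] * (((spA⁻¹ * (T * spB * T⁻¹) * spA).1 :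
      Matrix (Fin 3) (Fin 3) ℍ[ℝ]) * U)) =
      (fixedConjA' s)ᴴ * (formJ ℍ[ℝ] * ((spB.1 : Matrix (Fin 3) (Fin 3) ℍ[ℝ]) *
        fixedConjA' s)) := by
    -- W is an isometry conjugating A⁻¹ B' A to ρ_W(b), so the product can be evaluated at W U with
    -- the undeformed matrix.
    set W := T⁻¹ * spA with hW
    have hWU : (W.1 : Matrix (Fin 3) (Fin 3) ℍ[ℝ]) * U = fixedConjA' s := by
      have h1 : ((T⁻¹).1 : Matrix (Fin 3) (Fin 3) ℍ[ℝ]) * T.1 = 1 := T.1.inv_mul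
      rw [hW, Subgroup.coe_mul, Units.val_mul, Matrix.mul_assoc, spA_mul_fixedConj,
        ← jTranslation_mul_fixedConjA', ← Matrix.mul_assoc, h1, Matrix.one_mul]
    have hWJ : (W.1 : Matrix (Fin 3) (Fin 3) ℍ[ℝ])ᴴ * formJ ℍ[ℝ] * W.1 = formJ ℍ[ℝ] := W.2
    have hWW : (W.1 : Matrix (Fin 3) (Fin 3) ℍ[ℝ]) * (spA⁻¹ * (T * spB * T⁻¹) * spA).1 =
        spB.1 * W.1 :=
      congrArg (fun M : Sp21 => (M.1 : Matrix (Fin 3) (Fin 3) ℍ[ℝ]))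
        (show W * (spA⁻¹ * (T * spB * T⁻¹) * spA) = spB * W by rw [hW]; group)
    set C := ((spA⁻¹ * (T * spB * T⁻¹) * spA).1 : Matrix (Fin 3) (Fin 3) ℍ[ℝ])
    rw [← hWU, ← Matrix.mul_assoc (spB.1 : Matrix (Fin 3) (Fin 3) ℍ[ℝ]), ← hWW]
    calc Uᴴ * (formJ ℍ[ℝ] * (C * U))
        = Uᴴ * ((W.1 : Matrix (Fin 3) (Fin 3) ℍ[ℝ])ᴴ * formJ ℍ[ℝ] *
          (W.1 : Matrix (Fin 3) (Fin 3) ℍ[ℝ]) * (C * U)) := by rw [hWJ]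
      _ = _ := by simp only [Matrix.conjTranspose_mul, Matrix.mul_assoc]
  rw [hgram] at hy
  obtain ⟨hxI, hxJ⟩ := gram_fixedConjA s
  refine not_commute_of_mul_self hμ hxI ?_ ?_ hx hy
  · rw [hxJ]; simpa using hs
  · rw [gram_fixedConjA']; positivity

theorem proposition2p2 :
    ∃ ρ : unitInterval → (WhiteheadGroup →* Sp21),
      ρ 0 = rhoW ∧
      (∀ γ : WhiteheadGroup, Continuous fun t => ρ t γ) ∧
      ∀ t : unitInterval, t ≠ 0 → ¬ IsConjIntoU21 (ρ t) :=
  ⟨fun t => bending t, bending_zero,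
    fun γ => (continuous_bending γ).comp continuous_subtype_val,
    fun _ ht => not_isConjIntoU21_bending fun h => ht (Subtype.ext h)⟩
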